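/- Side-choosing 1v1 game with choice-free players. Players arrive in a Poisson process and are of three kinds: those who insist on side A (rate $\lambda_A\ge 0$), those who insist on side B (rate $\lambda_B\ge 0$), and choice-free players, who accept either side (rate $\lambda_C$); the three arrival streams are independent. Write $\lambda_{\mathrm{total}}=\lambda_A+\lambda_B+\lambda_C$ and assume the stability condition $\lambda_C>|\lambda_A-\lambda_B|$. Two players can play each other unless both insist on the same side. An arriving player is matched at once with the compatible waiting player who arrived first, and both leave; if there is none, the arriving player waits. The number of waiting players is described by the continuous-time Markov chain with state space $\mathbb Z\cup\{1'\}$ (state $i\ge 0$: $i$ A-players are waiting; state $-i\le 0$: $i$ B-players are waiting; state $1'$: one choice-free player is waiting) and transition rates - $i\to i+1$: $\lambda_A$ if $i\ge 0$, and $\lambda_A+\lambda_C$ if $i<0$; - $i\to i-1$: $\lambda_B$ if $i\le 0$, and $\lambda_B+\lambda_C$ if $i>0$; - $0\to 1'$: $\lambda_C$; and $1'\to 0$: $\lambda_{\mathrm{total}}$. This chain has a unique stationary distribution $\pi$, and $$\pi_0=\left(\frac{\lambda_A}{\lambda_B+\lambda_C-\lambda_A}+\frac{\lambda_B}{\lambda_A+\lambda_C-\lambda_B}+\frac{\lambda_C}{\lambda_{\mathrm{total}}}+1\right)^{-1}.$$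 Suppose that the state at time $0$ has distribution $\pi$, independently of the arrivals. For each player arriving after time $0$, let $\mathbb E[T]$ be the expected waiting time of this player, and let $\mathbb E[T_A],\mathbb E[T_B],\mathbb E[T_C]$ be the conditional expectations of the waiting time given that the player insists on A, insists on B, or is choice-free, respectively ($\mathbb E[T_A]$ is considered only if $\lambda_A>0$, and $\mathbb E[T_B]$ only if $\lambda_B>0$). Then these expectations are the same for all such players, and $$\mathbb E[T_A]=\frac{(\lambda_B+\lambda_C)\pi_0}{(\lambda_B+\lambda_C-\lambda_A)^2},\qquad \mathbb E[T_B]=\frac{(\lambda_A+\lambda_C)\pi_0}{(\lambda_A+\lambda_C-\lambda_B)^2},\qquad \mathbb E[T_C]=\frac{\pi_0}{\lambda_A+\lambda_B+\lambda_C},$$ $$\mathbb E[T]=\frac{1}{2(\lambda_A+\lambda_C-\lambda_B)}+\frac{1}{2(\lambda_B+\lambda_C-\lambda_A)}+\frac{1}{\lambda_A+\lambda_B+\lambda_C}-\frac{1}{2\lambda_C}-\frac{\lambda_A+\lambda_B+2\lambda_C}{2(2\lambda_A\lambda_B+\lambda_A\lambda_C+\lambda_B\lambda_C+\lambda_C^2)}.$$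 Moreover, if $\lambda_B>0$, then the improvement factor $q=\mathbb E[T_C]/\mathbb E[T_B]$ is $$q=\frac{(\lambda_{\mathrm{total}}-2\lambda_B)^2}{\lambda_{\mathrm{total}}(\lambda_{\mathrm{total}}-\lambda_B)}.$$ -/

import Mathlib

open MeasureTheory ProbabilityTheory
open scoped ENNReal

namespace SideQueue

/-- The three kinds of players: those who insist on side A, those who insist on side B, and the
choice-free players, who accept either side. -/
inductive Kind where
  | A
  | B
  | C
  deriving DecidableEq

instance : MeasurableSpace Kind := ⊤

/-- The arrival rate of each kind of players. -/
def arrivalRate (lamA lamB lamC : ℝ) : Kind → ℝ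
  | Kind.A => lamA
  | Kind.B => lamB
  | Kind.C => lamC

/-- The states of the Markov chain. For `i ≥ 0`, `side i` means that `i` players who chose side A
are waiting; `side (-i)` means that `i` players who chose side B are waiting (so `side 0` is the
empty system); `free` (the state `1'`) means that one choice-free player is waiting. -/
inductive State where
  | side (i : ℤ)
  | free

instance : MeasurableSpace State := ⊤

/-- The transition rates of the continuous-time Markov chain with choice-free players. -/
noncomputable def transitionRate (lamA lamB lamC : ℝ) : State → State → ℝ
  | .side i, .side j =>
      if j = i + 1 then (if 0 ≤ i then lamA else lamA + lamC)
      else if j = i - 1 then (if i ≤ 0 then lamB else lamB + lamC)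
      else 0
  | .side i, .free => if i = 0 then lamC else 0
  | .free, .side j => if j = 0 then lamA + lamB + lamC else 0
  | .free, .free => 0

/-- `p` is a stationary distribution of the Markov chain: a probability distribution on the states
for which the flow into each state equals the flow out of it. (All the sums over states in the
balance equations have at most finitely many nonzero terms.) -/
structure IsStationary (lamA lamB lamC : ℝ) (p : State → ℝ) : Prop where
  nonneg : ∀ x, 0 ≤ p x
  hasSum_one : HasSum p 1
  balance : ∀ y, ∑' x, p x * transitionRate lamA lamB lamC x y
    = p y * ∑' z, transitionRate lamA lamB lamC y z

/-- Two players can play a 1v1 game against each other unless both insist on the same side. -/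
def compatible : Kind → Kind → Bool
  | Kind.A, Kind.A => false
  | Kind.B, Kind.B => false
  | _, _ => true

/-- A waiting player: the label is `some n` for the `n`-th player to arrive after time `0`, and
`none` for a player already present at time `0`. -/
abbrev Player := Option ℕ × Kind

/-- First-in-first-out matchmaking. The waiting players are listed in the order of their arrival.
An arriving player starts a game at once with the compatible player who has waited longest, and
both leave; if no waiting player is compatible, then the arriving player joins the queue. -/
def arrive (q : List Player) (p : Player) : List Player :=
  if q.any (fun r => compatible p.2 r.2) then q.eraseP (fun r => compatible p.2 r.2)
  else q ++ [p]

/-- The players waiting at time `0` when the state at time `0` is given. -/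
def initialQueue : State → List Player
  | .side i =>
      if 0 ≤ i then List.replicate i.toNat (none, Kind.A)
      else List.replicate (-i).toNat (none, Kind.B)
  | .free => [(none, Kind.C)]

/-- The players waiting just before the arrival of player `m`, when `x` is the state at time `0` and
`kind n` is the kind of player `n`. -/
def queueBefore (x : State) (kind : ℕ → Kind) : ℕ → List Player
  | 0 => initialQueue x
  | m + 1 => arrive (queueBefore x kind m) (some m, kind m)

/-- Player `n` is in the queue just before the arrival of player `m`. -/
def IsWaiting (x : State) (kind : ℕ → Kind) (n m : ℕ) : Prop :=
  ∃ r ∈ queueBefore x kind m, r.1 = some n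

open Classical in
/-- The waiting time of player `n`: the total length of the periods between consecutive arrivals
during which player `n` is in the queue. Here `gap m` is the time between the arrivals of players
`m - 1` and `m` (for `m = 0`, between time `0` and the first arrival). It is `0` for a player who
is matched on arrival. -/
noncomputable def waitingTime (x : State) (kind : ℕ → Kind) (gap : ℕ → ℝ) (n : ℕ) : ℝ≥0∞ :=
  ∑' m, if IsWaiting x kind n m then ENNReal.ofReal (gap m) else 0

variable {Ω : Type*} [MeasurableSpace Ω]

/-- The random input of the queue in the stationary regime `p`: players arrive according to a
Poisson process of rate `lamA + lamB + lamC` (i.i.d. exponential times between arrivals), each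
arriving player is, independently, of kind A, B or C with probability proportional to
`lamA, lamB, lamC` (that is, the three kinds arrive according to independent Poisson processes of
these rates), and the state at time `0` has law `p` and is independent of the arrivals. -/
structure IsStationaryInput (lamA lamB lamC : ℝ) (p : State → ℝ) (P : Measure Ω)
    (X : Ω → State) (kind : ℕ → Ω → Kind) (gap : ℕ → Ω → ℝ) : Prop where
  measurable_state : Measurable X
  measurable_kind : ∀ n, Measurable (kind n)
  measurable_gap : ∀ n, Measurable (gap n)
  law_state : ∀ x, P {ω | X ω = x} = ENNReal.ofReal (p x)
  law_kind : ∀ n k, P {ω | kind n ω = k}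
    = ENNReal.ofReal (arrivalRate lamA lamB lamC k / (lamA + lamB + lamC))
  law_gap : ∀ n, P.map (gap n) = expMeasure (lamA + lamB + lamC)
  indep_kind : iIndepFun kind P
  indep_gap : iIndepFun gap P
  indep_kind_gap : IndepFun (fun ω n => kind n ω) (fun ω n => gap n ω) P
  indep_state : IndepFun X (fun ω => ((fun n => kind n ω), (fun n => gap n ω))) P

/-- The expected waiting time `E[T]` of player `n`, whatever the player's kind. -/
noncomputable def meanWait (P : Measure Ω) (X : Ω → State) (kind : ℕ → Ω → Kind)
    (gap : ℕ → Ω → ℝ) (n : ℕ) : ℝ≥0∞ :=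
  ∫⁻ ω, waitingTime (X ω) (fun m => kind m ω) (fun m => gap m ω) n ∂P

/-- The expected waiting time `E[T_k]` of a player of kind `k`: the conditional expectation of the
waiting time of player `n`, given that this player is of kind `k`. -/
noncomputable def meanWaitOf (P : Measure Ω) (X : Ω → State) (kind : ℕ → Ω → Kind)
    (gap : ℕ → Ω → ℝ) (k : Kind) (n : ℕ) : ℝ≥0∞ :=
  meanWait (P[|{ω | kind n ω = k}]) X kind gap n

end SideQueue

namespace SideQueue

/-! Every arrival changes the state, so every state is left at the same total rate. The chain seen
just before arrivals therefore has the transition rates divided by that total as its probabilities,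
and each arriving player sees the law π (`IsStationaryInput.law_stateBefore`). On each half-line the
balance equations together with summability force zero net flow across every cut. Hence π is
geometric there, with ratios a/(b+c) and b/(a+c), and the state `free` has mass π₀c/(a+b+c)
(`IsStationary.eq_weight`). Normalization gives π₀.

All waiting players are of one kind. By first-in-first-out, a player who finds i others of that kind
ahead and cannot be matched leaves with the (i+1)-th later compatible arrival (`isWaiting_iff`).
Later arrivals are independently compatible with probability ρ = `serviceRate`/(a+b+c), so the
number of periods between arrivals spent waiting has mean (i+1)/ρ (`hasSum_fewerThan`). Whether a
period is spent waiting depends only on the initial state and the kinds, hence is independent of its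
length, which has mean 1/(a+b+c) (`IsStationaryInput.setLIntegral_gap`). The mean wait given i is
thus (i+1)/`serviceRate`. Averaging over π gives π₀ · `relativeLoad`/`serviceRate` for each kind,
and E[T] is the mixture over the kinds. -/

/-! ### The chain seen at arrivals. -/

noncomputable instance : DecidableEq State := Classical.decEq _

instance : Fintype Kind := ⟨{Kind.A, Kind.B, Kind.C}, fun k => by cases k <;> simp⟩

theorem sum_kind {M : Type*} [AddCommMonoid M] (f : Kind → M) :
    ∑ k, f k = f .A + f .B + f .C := by
  have : (Finset.univ : Finset Kind) = {Kind.A, Kind.B, Kind.C} := rfl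
  rw [this]
  simp [add_assoc]

/-- The state after the arrival of a player of the given kind. -/
def next : State → Kind → State
  | .free, _ => .side 0
  | .side i, .A => .side (i + 1)
  | .side i, .B => .side (i - 1)
  | .side i, .C => if i = 0 then .free else if 0 < i then .side (i - 1) else .side (i + 1)

/-- The state just before the arrival of player `m`. -/
def stateBefore (x : State) (kind : ℕ → Kind) : ℕ → State
  | 0 => x
  | m + 1 => next (stateBefore x kind m) (kind m)

/-- The kinds of the waiting players, in the order of their arrival. -/
def waitingKinds : State → List Kind
  | .side i => if 0 ≤ i then List.replicate i.toNat .A else List.replicate (-i).toNat .B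
  | .free => [.C]

/-- The number of players ahead of a player of kind `k` who arrives in the given state and has to
wait; `none` if this player is matched at once. -/
def numAhead : Kind → State → Option ℕ
  | .A, .side i => if 0 ≤ i then some i.toNat else none
  | .B, .side i => if i ≤ 0 then some (-i).toNat else none
  | .C, .side i => if i = 0 then some 0 else none
  | _, .free => none

/-- The number of players among the `d` arrivals after player `n` who are compatible with `k`. -/
def served (k : Kind) (kind : ℕ → Kind) (n : ℕ) : ℕ → ℕ
  | 0 => 0
  | d + 1 => served k kind n d + if compatible (kind (n + 1 + d)) k then 1 else 0

/-- This links the rates of the continuous-time chain to the deterministic move `next` driven by the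
kind of the arriving player. -/
theorem transitionRate_eq_sum (a b c : ℝ) (x y : State) :
    transitionRate a b c x y = ∑ k, if next x k = y then arrivalRate a b c k else 0 := by
  rw [sum_kind]
  rcases x with i | _
  · rcases y with j | _
    · simp only [transitionRate, next, arrivalRate, State.side.injEq]
      rcases lt_trichotomy i 0 with h | h | h
      · simp only [h.ne, h.le, h.not_gt, h.not_ge, if_true, if_false, State.side.injEq]
        split_ifs <;> first | omega | simp
      · subst h
        simp only [le_refl, if_true, reduceCtorEq, if_false]
        split_ifs <;> first | omega | simp
      · simp only [h.ne', h.le, h, h.not_ge, if_true, if_false, State.side.injEq]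
        split_ifs <;> first | omega | simp
    · simp only [transitionRate, next, arrivalRate, reduceCtorEq, if_false]
      split_ifs <;> simp_all
  · rcases y with j | _
    · simp only [transitionRate, next, arrivalRate, State.side.injEq, eq_comm (a := (0 : ℤ))]
      split_ifs <;> simp
    · simp [transitionRate, next]

/-! ### From the labelled queue to the state, and the criterion for waiting. -/

theorem initialQueue_map_snd (x : State) : (initialQueue x).map Prod.snd = waitingKinds x := by
  rcases x with i | _
  · simp only [initialQueue, waitingKinds]
    split_ifs <;> simp
  · rfl

/-- Matching ignores labels, so the effect of an arrival on the kinds needs computing only for the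
queues `initialQueue x`. -/
theorem arrive_map_snd_congr {q q' : List Player} {p p' : Player}
    (hq : q.map Prod.snd = q'.map Prod.snd) (hp : p.2 = p'.2) :
    (arrive q p).map Prod.snd = (arrive q' p').map Prod.snd := by
  have key : ∀ (q : List Player) (p : Player), (arrive q p).map Prod.snd =
      if (q.map Prod.snd).any (fun r => compatible p.2 r) then
        (q.map Prod.snd).eraseP (fun r => compatible p.2 r) else q.map Prod.snd ++ [p.2] := by
    intro q p
    simp only [arrive, List.any_map, List.eraseP_map, Function.comp_def]
    split_ifs <;> simp
  rw [key, key, hq, hp]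

theorem arrive_initialQueue_map_snd (x : State) (p : Player) :
    (arrive (initialQueue x) p).map Prod.snd = waitingKinds (next x p.2) := by
  obtain ⟨l, k⟩ := p
  rcases x with i | _
  · rcases i with (_ | n) | n
    · cases k <;> simp [arrive, initialQueue, waitingKinds, next, compatible]
    · have h0 : (0 : ℤ) < (n : ℤ) + 1 := by omega
      have h1 : (0 : ℤ) ≤ (n : ℤ) + 1 := by omega
      have h2 : (0 : ℤ) ≤ (n : ℤ) + 1 + 1 := by omega
      have h3 : ((n : ℤ) + 1).toNat = n + 1 := by omega
      have h4 : ((n : ℤ) + 1 + 1).toNat = n + 1 + 1 := by omega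
      have h5 : (n : ℤ) + 1 ≠ 0 := by omega
      cases k
      · simp [arrive, initialQueue, waitingKinds, next, compatible, h1, h2, h3, h4,
          List.replicate_succ']
      · simp [arrive, initialQueue, waitingKinds, next, compatible, h1, h3, List.replicate_succ]
      · simp [arrive, initialQueue, waitingKinds, next, compatible, h0, h1, h3, h5,
          List.replicate_succ]
    · have h0 : ¬ (0 : ℤ) ≤ Int.negSucc n := by omega
      have h1 : (-Int.negSucc n).toNat = n + 1 := by omega
      have h2 : Int.negSucc n ≠ 0 := by omega
      have h3 : ¬ (0 : ℤ) < Int.negSucc n := by omega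
      have h4 : ¬ (0 : ℤ) ≤ Int.negSucc n - 1 := by omega
      have h5 : (-(Int.negSucc n - 1)).toNat = n + 1 + 1 := by omega
      have h6 : waitingKinds (.side (Int.negSucc n + 1)) = List.replicate n .B := by
        rcases n with _ | n
        · rfl
        · have e1 : ¬ (0 : ℤ) ≤ Int.negSucc (n + 1) + 1 := by omega
          have e2 : (-(Int.negSucc (n + 1) + 1)).toNat = n + 1 := by omega
          simp only [waitingKinds, e1, e2, if_false]
      cases k
      · rw [next, h6]
        simp only [arrive, initialQueue, h0, h1, if_false]
        simp [compatible, List.replicate_succ]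
      · simp only [arrive, initialQueue, next, waitingKinds, h0, h1, h4, h5, if_false]
        simp [compatible, List.replicate_succ']
      · simp only [next, h2, h3, if_false]
        rw [h6]
        simp only [arrive, initialQueue, h0, h1, if_false]
        simp [compatible, List.replicate_succ]
  · cases k <;> simp [arrive, initialQueue, waitingKinds, next, compatible]

theorem queueBefore_map_snd (x : State) (kind : ℕ → Kind) (m : ℕ) :
    (queueBefore x kind m).map Prod.snd = waitingKinds (stateBefore x kind m) := by
  induction m with
  | zero => exact initialQueue_map_snd x
  | succ m ih =>
    rw [queueBefore, stateBefore, arrive_map_snd_congr (ih.trans (initialQueue_map_snd _).symm)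
      (rfl : ((some m, kind m) : Player).2 = (some m, kind m).2), arrive_initialQueue_map_snd]

theorem mem_or_eq_of_mem_arrive {q : List Player} {p r : Player} (h : r ∈ arrive q p) :
    r ∈ q ∨ r = p := by
  unfold arrive at h
  split_ifs at h
  · exact .inl (List.mem_of_mem_eraseP h)
  · simpa using h

theorem label_lt_of_mem_queueBefore (x : State) (kind : ℕ → Kind) (m : ℕ) :
    ∀ r ∈ queueBefore x kind m, ∀ n, r.1 = some n → n < m := by
  induction m with
  | zero =>
    intro r hr n hn
    rcases x with i | _
    · simp only [queueBefore, initialQueue] at hr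
      split_ifs at hr <;> simp [List.eq_of_mem_replicate hr] at hn
    · simp only [queueBefore, initialQueue, List.mem_singleton] at hr
      simp [hr] at hn
  | succ m ih =>
    intro r hr n hn
    rcases mem_or_eq_of_mem_arrive hr with h | rfl
    · exact (ih r h n hn).trans (Nat.lt_succ_self m)
    · simp only [Option.some.injEq] at hn
      omega

theorem not_isWaiting_of_le {x : State} {kind : ℕ → Kind} {n m : ℕ} (h : m ≤ n) :
    ¬ IsWaiting x kind n m := by
  rintro ⟨r, hr, hn⟩
  exact absurd (label_lt_of_mem_queueBefore x kind m r hr n hn) (not_lt.mpr h)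

/-- Nobody who is compatible is present, so the queue consists of the player's own kind. The second
part records that two choice-free players never wait together. -/
theorem waitingKinds_of_numAhead_eq_some {k : Kind} {s : State} {i : ℕ}
    (h : numAhead k s = some i) :
    waitingKinds s = List.replicate i k ∧ (compatible k k = true → i = 0) := by
  rcases s with j | _
  · cases k
    · simp only [numAhead] at h
      split_ifs at h with hj
      simp only [Option.some.injEq] at h
      simp [waitingKinds, hj, h, compatible]
    · simp only [numAhead] at h
      split_ifs at h with hj
      simp only [Option.some.injEq] at h
      rcases hj.eq_or_lt with rfl | hj
      · simp [← h, waitingKinds, compatible]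
      · simp [waitingKinds, hj.not_ge, h, compatible]
    · simp only [numAhead] at h
      split_ifs at h with hj
      simp only [Option.some.injEq] at h
      simp [waitingKinds, hj, ← h]
  · cases k <;> simp [numAhead] at h

theorem exists_compatible_of_numAhead_eq_none {k : Kind} {s : State} (h : numAhead k s = none) :
    ∃ k' ∈ waitingKinds s, compatible k k' = true := by
  rcases s with j | _
  · cases k
    · simp only [numAhead] at h
      split_ifs at h with hj
      exact ⟨.B, by simp [waitingKinds, hj], rfl⟩
    · simp only [numAhead] at h
      split_ifs at h with hj
      exact ⟨.A, by simp [waitingKinds, (not_le.mp hj).le]; omega, rfl⟩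
    · simp only [numAhead] at h
      split_ifs at h with hj
      by_cases h0 : 0 ≤ j
      · exact ⟨.A, by simp [waitingKinds, h0]; omega, rfl⟩
      · exact ⟨.B, by simp [waitingKinds, h0], rfl⟩
  · exact ⟨.C, by simp [waitingKinds], by cases k <;> rfl⟩

theorem any_compatible_queueBefore (x : State) (kind : ℕ → Kind) (m : ℕ) (k : Kind) :
    (queueBefore x kind m).any (fun r => compatible k r.2) = true ↔
      ∃ k' ∈ waitingKinds (stateBefore x kind m), compatible k k' = true := by
  rw [← queueBefore_map_snd, List.any_eq_true]
  constructor
  · rintro ⟨r, hr, h⟩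
    exact ⟨r.2, List.mem_map_of_mem hr, h⟩
  · rintro ⟨k', hk', h⟩
    obtain ⟨r, hr, rfl⟩ := List.mem_map.1 hk'
    exact ⟨r, hr, h⟩

theorem eq_of_compatible_eq_false {k k' : Kind} (h : compatible k' k = false) : k' = k := by
  cases k <;> cases k' <;> simp_all [compatible]

theorem not_isWaiting_of_numAhead_eq_none {x : State} {kind : ℕ → Kind} {n : ℕ}
    (h : numAhead (kind n) (stateBefore x kind n) = none) (d : ℕ) :
    ¬ IsWaiting x kind n (n + 1 + d) := by
  induction d with
  | zero =>
    rintro ⟨r, hr, hn⟩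
    have h' := (any_compatible_queueBefore x kind n (kind n)).2
      (exists_compatible_of_numAhead_eq_none h)
    simp only [queueBefore, arrive, h', if_true] at hr
    exact lt_irrefl n
      (label_lt_of_mem_queueBefore x kind n r (List.mem_of_mem_eraseP hr) n hn)
  | succ d ih =>
    rintro ⟨r, hr, hn⟩
    rcases mem_or_eq_of_mem_arrive hr with h | rfl
    · exact ih ⟨r, h, hn⟩
    · have hn' : n + 1 + d = n := Option.some.inj hn
      omega

/-- While player `n` waits, the players ahead leave one by one whenever a compatible player
arrives. -/
theorem queueBefore_of_numAhead_eq_some {x : State} {kind : ℕ → Kind} {n i : ℕ}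
    (h : numAhead (kind n) (stateBefore x kind n) = some i) (d : ℕ) :
    (∃ l₁ l₂ : List Player, queueBefore x kind (n + 1 + d) = l₁ ++ (some n, kind n) :: l₂ ∧
        l₁.length + served (kind n) kind n d = i ∧
        (∀ r ∈ queueBefore x kind (n + 1 + d), r.2 = kind n) ∧ ∀ r ∈ l₁ ++ l₂, r.1 ≠ some n) ∨
      (i < served (kind n) kind n d ∧ ∀ r ∈ queueBefore x kind (n + 1 + d), r.1 ≠ some n) := by
  induction d with
  | zero =>
    obtain ⟨hw, hc⟩ := waitingKinds_of_numAhead_eq_some h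
    have hmap := (queueBefore_map_snd x kind n).trans hw
    have hlen : (queueBefore x kind n).length = i := by simpa using congrArg List.length hmap
    have hall : ∀ r ∈ queueBefore x kind n, r.2 = kind n := fun r hr =>
      List.eq_of_mem_replicate (hmap ▸ List.mem_map_of_mem (f := Prod.snd) hr)
    have hany : ¬ (queueBefore x kind n).any (fun r => compatible (kind n) r.2) = true := by
      rw [any_compatible_queueBefore, hw]
      rintro ⟨k', hk', hcomp⟩
      obtain rfl := List.eq_of_mem_replicate hk'
      simp [hc hcomp] at hk'
    have hq : queueBefore x kind (n + 1) = queueBefore x kind n ++ [(some n, kind n)] := by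
      simp only [queueBefore, arrive, hany, Bool.false_eq_true, if_false]
    refine .inl ⟨queueBefore x kind n, [], hq, by simp [served, hlen], ?_, ?_⟩
    · intro r hr
      rw [Nat.add_zero, hq] at hr
      rcases List.mem_append.1 hr with hr | hr
      · exact hall r hr
      · simp [List.mem_singleton.1 hr]
    · intro r hr hn
      rw [List.append_nil] at hr
      exact lt_irrefl n (label_lt_of_mem_queueBefore x kind n r hr n hn)
  | succ d ih =>
    have hne : n + 1 + d ≠ n := by omega
    have hq : queueBefore x kind (n + 1 + (d + 1)) =
        arrive (queueBefore x kind (n + 1 + d)) (some (n + 1 + d), kind (n + 1 + d)) := rfl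
    rcases ih with ⟨l₁, l₂, hl, hlen, hall, hlab⟩ | ⟨hlt, hlab⟩
    · by_cases hcomp : compatible (kind (n + 1 + d)) (kind n) = true
      · have hs : served (kind n) kind n (d + 1) = served (kind n) kind n d + 1 := by
          simp [served, hcomp]
        have hany : (queueBefore x kind (n + 1 + d)).any
            (fun r => compatible (kind (n + 1 + d)) r.2) = true :=
          List.any_eq_true.2 ⟨(some n, kind n), by simp [hl], hcomp⟩
        rw [arrive, if_pos hany, hl] at hq
        -- All waiting players have the kind of player `n`, so the arrival takes the head of the
        -- queue: player `n` if nobody is ahead, otherwise one of those ahead.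
        rcases l₁ with _ | ⟨r₀, l₁⟩
        · rw [List.nil_append, List.eraseP_cons_of_pos (by exact hcomp)] at hq
          refine .inr ⟨by simp at hlen; omega, fun r hr => hlab r ?_⟩
          simpa [hq] using hr
        · have hr₀ : compatible (kind (n + 1 + d)) r₀.2 = true := by
            rw [hall r₀ (by simp [hl])]
            exact hcomp
          rw [List.cons_append, List.eraseP_cons_of_pos (by exact hr₀)] at hq
          refine .inl ⟨l₁, l₂, hq, by simp at hlen; omega, fun r hr => hall r ?_,
            fun r hr => hlab r (by rw [List.cons_append]; exact List.mem_cons_of_mem _ hr)⟩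
          rw [hl, List.cons_append]
          rw [hq] at hr
          exact List.mem_cons_of_mem _ hr
      -- An incompatible arrival has the same kind as player `n` and joins at the back, which
      -- preserves the invariant.
      · rw [Bool.not_eq_true] at hcomp
        have hs : served (kind n) kind n (d + 1) = served (kind n) kind n d := by
          simp [served, hcomp]
        have hany : ¬ (queueBefore x kind (n + 1 + d)).any
            (fun r => compatible (kind (n + 1 + d)) r.2) = true := by
          rw [List.any_eq_true]
          rintro ⟨r, hr, hr'⟩
          rw [hall r hr, hcomp] at hr'
          exact absurd hr' (by simp)
        rw [arrive, if_neg hany] at hq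
        refine .inl ⟨l₁, l₂ ++ [(some (n + 1 + d), kind (n + 1 + d))], by rw [hq, hl]; simp,
          by omega, ?_, ?_⟩
        · intro r hr
          rw [hq] at hr
          rcases List.mem_append.1 hr with hr | hr
          · exact hall r hr
          · rw [List.mem_singleton.1 hr]
            exact eq_of_compatible_eq_false hcomp
        · intro r hr
          rw [← List.append_assoc] at hr
          rcases List.mem_append.1 hr with hr | hr
          · exact hlab r hr
          · rw [List.mem_singleton.1 hr]
            simpa using hne
    · refine .inr ⟨hlt.trans_le (by simp [served]), fun r hr => ?_⟩
      rw [hq] at hr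
      rcases mem_or_eq_of_mem_arrive hr with hr | rfl
      · exact hlab r hr
      · simpa using hne

/-- The wait is expressed through the state found on arrival and a count of later arrivals; these
are independent once the kind is fixed. -/
theorem isWaiting_iff (x : State) (kind : ℕ → Kind) (n d : ℕ) :
    IsWaiting x kind n (n + 1 + d) ↔
      ∃ i, numAhead (kind n) (stateBefore x kind n) = some i ∧
        served (kind n) kind n d < i + 1 := by
  cases h : numAhead (kind n) (stateBefore x kind n) with
  | none => simp [not_isWaiting_of_numAhead_eq_none h d]
  | some i =>
    simp only [Option.some.injEq, exists_eq_left']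
    rcases queueBefore_of_numAhead_eq_some h d with ⟨l₁, l₂, hl, hlen, -, -⟩ | ⟨hlt, hlab⟩
    · exact iff_of_true ⟨(some n, kind n), by simp [hl], rfl⟩ (by omega)
    · refine iff_of_false ?_ (by omega)
      rintro ⟨r, hr, hn⟩
      exact hlab r hr hn

/-! ### The stationary distribution. -/

theorem hasSum_state {M : Type*} [AddCommMonoid M] [TopologicalSpace M] [ContinuousAdd M]
    {f : State → M} {a b : M} (ha : HasSum (fun n : ℕ => f (.side n)) a)
    (hb : HasSum (fun n : ℕ => f (.side (-((n : ℤ) + 1)))) b) :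
    HasSum f (a + b + f .free) := by
  have hside : HasSum (fun i : ℤ => f (.side i)) (a + b) :=
    HasSum.of_nat_of_neg_add_one ha hb
  have hinj : Function.Injective State.side := fun i j h => State.side.inj h
  have h1 : HasSum (fun x : State => if x = .free then 0 else f x) (a + b) := by
    rw [← hinj.hasSum_iff]
    · simpa [Function.comp_def] using hside
    · intro x hx
      rcases x with i | _
      · exact absurd ⟨i, rfl⟩ hx
      · simp
  have h2 : HasSum (fun x : State => if x = .free then f .free else 0) (f .free) :=
    hasSum_ite_eq _ _
  convert h1.add h2 using 2 with x
  by_cases hx : x = .free <;> simp [hx]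

theorem hasSum_transitionRate (a b c : ℝ) (y : State) :
    HasSum (fun z => transitionRate a b c y z) (a + b + c) := by
  have : HasSum (fun z => ∑ k, if next y k = z then arrivalRate a b c k else 0)
      (∑ k, arrivalRate a b c k) :=
    hasSum_sum fun k _ => by
      simpa only [eq_comm] using hasSum_ite_eq (next y k) (arrivalRate a b c k)
  simpa only [transitionRate_eq_sum, sum_kind, arrivalRate] using this

theorem tsum_inflow_side (a b c : ℝ) (p : State → ℝ) (j : ℤ) :
    ∑' x, p x * transitionRate a b c x (.side j)
      = p (.side (j - 1)) * (if 0 ≤ j - 1 then a else a + c)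
        + p (.side (j + 1)) * (if j + 1 ≤ 0 then b else b + c)
        + p .free * (if j = 0 then a + b + c else 0) := by
  rw [tsum_eq_sum (s := {.side (j - 1), .side (j + 1), .free})]
  · have h1 : State.side (j - 1) ∉ ({.side (j + 1), .free} : Finset State) := by
      simp
      omega
    have h2 : State.side (j + 1) ∉ ({.free} : Finset State) := by simp
    rw [Finset.sum_insert h1, Finset.sum_insert h2, Finset.sum_singleton]
    have h3 : ¬ j = j + 1 + 1 := by omega
    have h4 : j = j + 1 - 1 := by omega
    have h5 : j = j - 1 + 1 := by omega
    simp only [transitionRate, if_neg h3, ← h4, ← h5, if_true]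
    ring
  · intro x hx
    rcases x with i | _
    · simp only [Finset.mem_insert, State.side.injEq, Finset.mem_singleton, reduceCtorEq,
        or_false, not_or] at hx
      have h1 : ¬ j = i + 1 := by omega
      have h2 : ¬ j = i - 1 := by omega
      simp [transitionRate, h1, h2]
    · simp at hx

theorem tsum_inflow_free (a b c : ℝ) (p : State → ℝ) :
    ∑' x, p x * transitionRate a b c x .free = p (.side 0) * c := by
  rw [tsum_eq_single (.side 0)]
  · simp [transitionRate]
  · intro x hx
    rcases x with i | _
    · have : i ≠ 0 := fun h => hx (by rw [h])
      simp [transitionRate, this]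
    · simp [transitionRate]

theorem IsStationary.tsum_inflow {a b c : ℝ} {p : State → ℝ} (hp : IsStationary a b c p)
    (y : State) : ∑' x, p x * transitionRate a b c x y = p y * (a + b + c) := by
  rw [hp.balance, (hasSum_transitionRate a b c y).tsum_eq]

/-- A summable sequence with balanced flow is geometric: the net flow across each cut is `0`. -/
theorem eq_geometric_of_balance {s : ℕ → ℝ} (hs : Summable s) {u v : ℝ} (hv : v ≠ 0)
    (h : ∀ n, s n * u + s (n + 2) * v = s (n + 1) * (u + v)) (n : ℕ) :
    s n = s 0 * (u / v) ^ n := by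
  have hconst : ∀ n, s (n + 1) * v - s n * u = s 1 * v - s 0 * u := by
    intro n
    induction n with
    | zero => simp
    | succ n ih =>
      rw [← ih]
      linear_combination h n
  -- The flow across a cut is constant in `n`, and summability lets it tend only to 0.
  have hlim : Filter.Tendsto (fun n => s (n + 1) * v - s n * u) Filter.atTop (nhds 0) := by
    have h0 := hs.tendsto_atTop_zero
    simpa using ((h0.comp (Filter.tendsto_add_atTop_nat 1)).mul_const v).sub (h0.mul_const u)
  have hzero : s 1 * v - s 0 * u = 0 :=
    tendsto_nhds_unique (tendsto_const_nhds.congr fun n => (hconst n).symm) hlim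
  induction n with
  | zero => simp
  | succ n ih =>
    have := hconst n
    rw [hzero, ih] at this
    rw [pow_succ]
    field_simp
    linear_combination this

/-- The normalizing constant of the stationary distribution. -/
noncomputable def normalization (a b c : ℝ) : ℝ :=
  a / (b + c - a) + b / (a + c - b) + c * (a + b + c)⁻¹ + 1

/-- The weight of each state relative to the empty system. -/
noncomputable def weight (a b c : ℝ) : State → ℝ
  | .side i => if 0 ≤ i then (a / (b + c)) ^ i.toNat else (b / (a + c)) ^ (-i).toNat
  | .free => c / (a + b + c)

theorem hasSum_weight {a b c : ℝ} (ha : 0 ≤ a) (hb : 0 ≤ b) (hc : |a - b| < c) :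
    HasSum (weight a b c) (normalization a b c) := by
  obtain ⟨h1, h2⟩ := abs_lt.1 hc
  have hbc : 0 < b + c := by linarith
  have hac : 0 < a + c := by linarith
  have hA : HasSum (fun n : ℕ => weight a b c (.side n)) (1 - a / (b + c))⁻¹ := by
    simpa [weight] using hasSum_geometric_of_lt_one (r := a / (b + c)) (div_nonneg ha hbc.le)
      (by rw [div_lt_one hbc]; linarith)
  have hB : HasSum (fun n : ℕ => weight a b c (.side (-((n : ℤ) + 1))))
      (b / (a + c) * (1 - b / (a + c))⁻¹) := by
    refine ((hasSum_geometric_of_lt_one (r := b / (a + c)) (div_nonneg hb hac.le)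
      (by rw [div_lt_one hac]; linarith)).mul_left (b / (a + c))).congr_fun fun n => ?_
    have e1 : ¬ (0 : ℤ) ≤ -((n : ℤ) + 1) := by omega
    have e2 : (-(-((n : ℤ) + 1))).toNat = n + 1 := by omega
    simp only [weight, e1, e2, if_false]
    ring
  convert hasSum_state hA hB using 1
  have e1 : b + c - a ≠ 0 := by linarith
  have e2 : a + c - b ≠ 0 := by linarith
  have e3 : 1 - a / (b + c) = (b + c - a) / (b + c) := by field_simp
  have e4 : 1 - b / (a + c) = (a + c - b) / (a + c) := by field_simp
  rw [e3, e4, normalization, weight]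
  field_simp
  ring

theorem weight_nonneg {a b c : ℝ} (ha : 0 ≤ a) (hb : 0 ≤ b) (hc : |a - b| < c) (x : State) :
    0 ≤ weight a b c x := by
  have h0 : 0 ≤ c := (abs_nonneg _).trans hc.le
  rcases x with i | _
  · simp only [weight]
    split_ifs <;> positivity
  · simp only [weight]
    positivity

theorem normalization_pos {a b c : ℝ} (ha : 0 ≤ a) (hb : 0 ≤ b) (hc : |a - b| < c) :
    0 < normalization a b c := by
  obtain ⟨h1, h2⟩ := abs_lt.1 hc
  have h0 : 0 ≤ c := (abs_nonneg _).trans hc.le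
  have e1 : 0 < b + c - a := by linarith
  have e2 : 0 < a + c - b := by linarith
  unfold normalization
  positivity

theorem weight_side_natCast (a b c : ℝ) (n : ℕ) :
    weight a b c (.side n) = (a / (b + c)) ^ n := by
  simp [weight]

theorem weight_side_neg_natCast (a b c : ℝ) (n : ℕ) :
    weight a b c (.side (-n)) = (b / (a + c)) ^ n := by
  rcases n with _ | n
  · simp [weight]
  · have e1 : ¬ (0 : ℤ) ≤ -((n + 1 : ℕ) : ℤ) := by omega
    simp only [weight, e1, if_false, neg_neg, Int.toNat_natCast]

/-- The balance equations away from `side 0` suffice: those on each half-line give the geometric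
ratio, and the one at `free` gives its weight. -/
theorem IsStationary.eq_weight {a b c : ℝ} (ha : 0 ≤ a) (hb : 0 ≤ b) (hc : |a - b| < c)
    {p : State → ℝ} (hp : IsStationary a b c p) (x : State) :
    p x = p (.side 0) * weight a b c x := by
  obtain ⟨h1, h2⟩ := abs_lt.1 hc
  have hbc : b + c ≠ 0 := (ha.trans_lt (by linarith)).ne'
  have hac : a + c ≠ 0 := (hb.trans_lt (by linarith)).ne'
  have hsum := hp.hasSum_one.summable
  rcases x with i | _
  · obtain ⟨n, rfl | rfl⟩ := i.eq_nat_or_neg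
    · have hs : Summable fun n : ℕ => p (.side n) :=
        hsum.comp_injective (i := fun n : ℕ => State.side n) fun m n h => by simpa using h
      rw [weight_side_natCast, eq_geometric_of_balance hs (u := a) (v := b + c) hbc _ n,
        Nat.cast_zero]
      intro n
      have h := hp.tsum_inflow (.side ((n + 1 : ℕ) : ℤ))
      rw [tsum_inflow_side] at h
      have e1 : (0 : ℤ) ≤ ((n + 1 : ℕ) : ℤ) - 1 := by omega
      have e2 : ¬ ((n + 1 : ℕ) : ℤ) + 1 ≤ 0 := by omega
      have e3 : ¬ ((n + 1 : ℕ) : ℤ) = 0 := by omega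
      have e4 : ((n + 1 : ℕ) : ℤ) - 1 = n := by omega
      have e5 : ((n + 1 : ℕ) : ℤ) + 1 = (n + 2 : ℕ) := by omega
      rw [if_pos e1, if_neg e2, if_neg e3, e4, e5] at h
      linear_combination h
    · have hs : Summable fun n : ℕ => p (.side (-n)) :=
        hsum.comp_injective (i := fun n : ℕ => State.side (-n)) fun m n h => by simpa using h
      rw [weight_side_neg_natCast,
        eq_geometric_of_balance hs (u := b) (v := a + c) hac _ n,
        Nat.cast_zero, neg_zero]
      intro n
      have h := hp.tsum_inflow (.side (-((n + 1 : ℕ) : ℤ)))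
      rw [tsum_inflow_side] at h
      have e1 : ¬ (0 : ℤ) ≤ -((n + 1 : ℕ) : ℤ) - 1 := by omega
      have e2 : -((n + 1 : ℕ) : ℤ) + 1 ≤ 0 := by omega
      have e3 : ¬ -((n + 1 : ℕ) : ℤ) = 0 := by omega
      have e4 : -((n + 1 : ℕ) : ℤ) - 1 = -(n + 2 : ℕ) := by omega
      have e5 : -((n + 1 : ℕ) : ℤ) + 1 = -n := by omega
      rw [if_neg e1, if_pos e2, if_neg e3, e4, e5] at h
      linear_combination h
  · have h := hp.tsum_inflow .free
    rw [tsum_inflow_free] at h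
    have : a + b + c ≠ 0 := by linarith
    rw [weight]
    field_simp
    linarith

theorem IsStationary.side_zero_eq {a b c : ℝ} (ha : 0 ≤ a) (hb : 0 ≤ b) (hc : |a - b| < c)
    {p : State → ℝ} (hp : IsStationary a b c p) : p (.side 0) = (normalization a b c)⁻¹ := by
  have h := ((hasSum_weight ha hb hc).mul_left (p (.side 0))).unique
    (hp.hasSum_one.congr_fun fun x => (hp.eq_weight ha hb hc x).symm)
  exact eq_inv_of_mul_eq_one_left h

theorem isStationary_weight {a b c : ℝ} (ha : 0 ≤ a) (hb : 0 ≤ b) (hc : |a - b| < c) :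
    IsStationary a b c fun x => (normalization a b c)⁻¹ * weight a b c x := by
  obtain ⟨h1, h2⟩ := abs_lt.1 hc
  have hN := normalization_pos ha hb hc
  refine ⟨fun x => mul_nonneg (inv_nonneg.2 hN.le) (weight_nonneg ha hb hc x), ?_, fun y => ?_⟩
  · simpa [hN.ne'] using (hasSum_weight ha hb hc).mul_left (normalization a b c)⁻¹
  have hbc : b + c ≠ 0 := by linarith
  have hac : a + c ≠ 0 := by linarith
  have htot : a + b + c ≠ 0 := by linarith
  rw [(hasSum_transitionRate a b c y).tsum_eq]
  simp only [mul_assoc, tsum_mul_left]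
  congr 1
  rcases y with i | _
  · rw [tsum_inflow_side]
    obtain ⟨n, rfl | rfl⟩ := i.eq_nat_or_neg
    · rcases n with _ | n
      · have e1 : weight a b c (.side (((0 : ℕ) : ℤ) - 1)) = b / (a + c) := by simp [weight]
        have e2 : weight a b c (.side (((0 : ℕ) : ℤ) + 1)) = a / (b + c) := by simp [weight]
        have e3 : weight a b c (.side ((0 : ℕ) : ℤ)) = 1 := by simp [weight]
        rw [e1, e2, e3, weight]
        norm_num
        field_simp
        ring
      · have e1 : (0 : ℤ) ≤ ((n + 1 : ℕ) : ℤ) - 1 := by omega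
        have e2 : ¬ ((n + 1 : ℕ) : ℤ) + 1 ≤ 0 := by omega
        have e3 : ¬ ((n + 1 : ℕ) : ℤ) = 0 := by omega
        have e4 : ((n + 1 : ℕ) : ℤ) - 1 = n := by omega
        have e5 : ((n + 1 : ℕ) : ℤ) + 1 = (n + 2 : ℕ) := by omega
        rw [if_pos e1, if_neg e2, if_neg e3, e4, e5]
        simp only [weight_side_natCast, pow_succ]
        field_simp
        ring
    · rcases n with _ | n
      · have e1 : weight a b c (.side (-((0 : ℕ) : ℤ) - 1)) = b / (a + c) := by simp [weight]
        have e2 : weight a b c (.side (-((0 : ℕ) : ℤ) + 1)) = a / (b + c) := by simp [weight]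
        have e3 : weight a b c (.side (-((0 : ℕ) : ℤ))) = 1 := by simp [weight]
        rw [e1, e2, e3, weight]
        norm_num
        field_simp
        ring
      · have e1 : ¬ (0 : ℤ) ≤ -((n + 1 : ℕ) : ℤ) - 1 := by omega
        have e2 : -((n + 1 : ℕ) : ℤ) + 1 ≤ 0 := by omega
        have e3 : ¬ -((n + 1 : ℕ) : ℤ) = 0 := by omega
        have e4 : -((n + 1 : ℕ) : ℤ) - 1 = -(n + 2 : ℕ) := by omega
        have e5 : -((n + 1 : ℕ) : ℤ) + 1 = -n := by omega
        rw [if_neg e1, if_pos e2, if_neg e3, e4, e5]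
        simp only [weight_side_neg_natCast, pow_succ]
        field_simp
        ring
  · rw [tsum_inflow_free, weight, weight]
    simp
    field_simp

/-! ### The mean load found by an arriving player. -/

/-- The rate at which the players compatible with a given kind arrive. -/
def serviceRate (a b c : ℝ) : Kind → ℝ
  | .A => b + c
  | .B => a + c
  | .C => a + b + c

/-- The stationary mean of the number of compatible arrivals that an arriving player of kind `k`
waits for, relative to the probability of the empty system. -/
noncomputable def relativeLoad (a b c : ℝ) : Kind → ℝ
  | .A => ((b + c) / (b + c - a)) ^ 2
  | .B => ((a + c) / (a + c - b)) ^ 2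
  | .C => 1

theorem hasSum_nat_succ_mul_geometric {r : ℝ} (h0 : 0 ≤ r) (h1 : r < 1) :
    HasSum (fun n : ℕ => r ^ n * ((n : ℝ) + 1)) (1 / (1 - r) ^ 2) := by
  have := hasSum_choose_mul_geometric_of_norm_lt_one 1
    (show ‖r‖ < 1 by rwa [Real.norm_of_nonneg h0])
  refine this.congr_fun fun n => ?_
  simp [mul_comm]

/-- With i players ahead, i + 1 compatible arrivals are needed: one for each of them and one for the
player. A player matched at once contributes 0. -/
theorem hasSum_weight_mul_numAhead {a b c : ℝ} (ha : 0 ≤ a) (hb : 0 ≤ b) (hc : |a - b| < c)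
    (k : Kind) : HasSum (fun x => weight a b c x *
      (numAhead k x).elim 0 (fun i => (i : ℝ) + 1)) (relativeLoad a b c k) := by
  obtain ⟨h1, h2⟩ := abs_lt.1 hc
  have hbc : 0 < b + c := by linarith
  have hac : 0 < a + c := by linarith
  have hbca : b + c - a ≠ 0 := by linarith
  have hacb : a + c - b ≠ 0 := by linarith
  cases k
  · have hA : HasSum (fun n : ℕ => weight a b c (.side n) *
        (numAhead .A (.side n)).elim 0 (fun i => (i : ℝ) + 1)) (relativeLoad a b c .A) := by
      convert hasSum_nat_succ_mul_geometric (r := a / (b + c)) (div_nonneg ha hbc.le)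
        (by rw [div_lt_one hbc]; linarith) using 1
      · funext n
        simp [weight_side_natCast, numAhead]
      · have : 1 - a / (b + c) = (b + c - a) / (b + c) := by field_simp
        rw [this, relativeLoad]
        field_simp
    have h0 : HasSum (fun n : ℕ => weight a b c (.side (-((n : ℤ) + 1))) *
        (numAhead .A (.side (-((n : ℤ) + 1)))).elim 0 (fun i => (i : ℝ) + 1)) 0 := by
      convert hasSum_zero using 1
      funext n
      have : ¬ (0 : ℤ) ≤ -((n : ℤ) + 1) := by omega
      simp only [numAhead, this, if_false, Option.elim_none, mul_zero]
    simpa [numAhead] using hasSum_state (f := fun x => weight a b c x *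
      (numAhead .A x).elim 0 (fun i => (i : ℝ) + 1)) hA h0
  · have hB : HasSum (fun n : ℕ => weight a b c (.side (-n)) *
        (numAhead .B (.side (-n))).elim 0 (fun i => (i : ℝ) + 1)) (relativeLoad a b c .B) := by
      convert hasSum_nat_succ_mul_geometric (r := b / (a + c)) (div_nonneg hb hac.le)
        (by rw [div_lt_one hac]; linarith) using 1
      · funext n
        simp [weight_side_neg_natCast, numAhead]
      · have : 1 - b / (a + c) = (a + c - b) / (a + c) := by field_simp
        rw [this, relativeLoad]
        field_simp
    have h0 : HasSum (fun n : ℕ => weight a b c (.side n) *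
        (numAhead .B (.side n)).elim 0 (fun i => (i : ℝ) + 1)) 1 := by
      have h := hasSum_single (f := fun n : ℕ => weight a b c (.side n) *
        (numAhead .B (.side n)).elim 0 (fun i => (i : ℝ) + 1)) 0 fun n hn => by
          simp [numAhead, hn]
      simpa [numAhead, weight] using h
    -- `hasSum_state` counts `side 0` in the nonnegative half, where `h0` gives it the value 1, so
    -- its term is removed from the series over the nonpositive half.
    have hB' := (hasSum_nat_add_iff' 1).2 hB
    simp only [Nat.cast_add, Nat.cast_one, Finset.range_one, Finset.sum_singleton] at hB'
    have h := hasSum_state (f := fun x => weight a b c x *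
      (numAhead .B x).elim 0 (fun i => (i : ℝ) + 1)) h0 hB'
    simpa [numAhead, weight] using h
  · have h := hasSum_single (f := fun x => weight a b c x *
      (numAhead .C x).elim 0 (fun i => (i : ℝ) + 1)) (.side 0) fun x hx => by
        rcases x with i | _
        · have : i ≠ 0 := fun h => hx (by rw [h])
          simp [numAhead, this]
        · simp [numAhead]
    simpa [numAhead, weight, relativeLoad] using h

/-! ### Independence, exponential means and waiting for the j-th success. -/

/-- Both hypotheses factor the joint law into a triple product measure, and reassociating this
product gives the claim. -/
theorem indepFun_prodMk_left {Ω α β γ : Type*} [MeasurableSpace Ω] [MeasurableSpace α]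
    [MeasurableSpace β] [MeasurableSpace γ] {P : Measure Ω} [IsProbabilityMeasure P]
    {X : Ω → α} {Y : Ω → β} {Z : Ω → γ} (hX : Measurable X) (hY : Measurable Y)
    (hZ : Measurable Z) (h : IndepFun X (fun ω => (Y ω, Z ω)) P) (hYZ : IndepFun Y Z P) :
    IndepFun (fun ω => (X ω, Y ω)) Z P := by
  have := Measure.isProbabilityMeasure_map (μ := P) hX.aemeasurable
  have := Measure.isProbabilityMeasure_map (μ := P) hY.aemeasurable
  have := Measure.isProbabilityMeasure_map (μ := P) hZ.aemeasurable
  have hXY : IndepFun X Y P := h.comp (φ := id) (ψ := Prod.fst) measurable_id measurable_fst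
  rw [indepFun_iff_map_prod_eq_prod_map_map (by fun_prop) (by fun_prop),
    hXY.map_prod_eq_prod_map_map (by fun_prop) (by fun_prop),
    ← ((measurePreserving_prodAssoc (P.map X) (P.map Y) (P.map Z)).symm _).map_eq,
    ← hYZ.map_prod_eq_prod_map_map (by fun_prop) (by fun_prop),
    ← h.map_prod_eq_prod_map_map (by fun_prop) (by fun_prop),
    Measure.map_map (by fun_prop) (by fun_prop)]
  rfl

theorem measure_eq_tsum_inter_fiber {Ω β : Type*} [MeasurableSpace Ω] [MeasurableSpace β]
    [MeasurableSingletonClass β] [Countable β] (P : Measure Ω) {S : Set Ω} (hS : MeasurableSet S)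
    {f : Ω → β} (hf : Measurable f) : P S = ∑' y, P (S ∩ f ⁻¹' {y}) := by
  rw [← measure_iUnion]
  · congr 1
    ext ω
    simp
  · intro x y hxy
    refine Set.disjoint_left.2 fun ω h1 h2 => hxy ?_
    exact (h1.2 : f ω = x).symm.trans h2.2
  · exact fun y => hS.inter (hf (measurableSet_singleton y))

/-- Multiplying the exponential density by x gives 1/r times the Gamma(2, r) density, which has
integral 1. -/
theorem lintegral_ofReal_expMeasure {r : ℝ} (hr : 0 < r) :
    ∫⁻ x, ENNReal.ofReal x ∂(expMeasure r) = ENNReal.ofReal (1 / r) := by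
  have hpdf : ∀ x : ℝ, gammaPDF 1 r x * ENNReal.ofReal x
      = ENNReal.ofReal (1 / r) * gammaPDF 2 r x := by
    intro x
    rcases lt_or_ge x 0 with hx | hx
    · simp [gammaPDF_of_neg hx]
    · rw [gammaPDF_of_nonneg hx, gammaPDF_of_nonneg hx, ← ENNReal.ofReal_mul (by positivity),
        ← ENNReal.ofReal_mul (by positivity)]
      congr 1
      have : (2 : ℝ) - 1 = 1 := by norm_num
      simp [this]
      field_simp
  have hm : ∀ a, Measurable (gammaPDF a r) := fun a =>
    (measurable_gammaPDFReal a r).ennreal_ofReal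
  rw [expMeasure, gammaMeasure, lintegral_withDensity_eq_lintegral_mul _ (hm 1) (by fun_prop)]
  simp only [Pi.mul_apply, hpdf]
  rw [lintegral_const_mul _ (hm 2), lintegral_gammaPDF_eq_one two_pos hr, mul_one]

/-- The probability that fewer than `j` of `d` independent arrivals are compatible, if each is with
probability `ρ`. -/
def fewerThan (ρ : ℝ) : ℕ → ℕ → ℝ
  | _, 0 => 0
  | 0, _ + 1 => 1
  | d + 1, j + 1 => (1 - ρ) * fewerThan ρ d (j + 1) + ρ * fewerThan ρ d j

theorem fewerThan_nonneg {ρ : ℝ} (h0 : 0 ≤ ρ) (h1 : ρ ≤ 1) (d j : ℕ) : 0 ≤ fewerThan ρ d j := by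
  induction d generalizing j with
  | zero => cases j <;> simp [fewerThan]
  | succ d ih =>
    rcases j with _ | j
    · simp [fewerThan]
    · have := sub_nonneg.2 h1
      exact add_nonneg (mul_nonneg this (ih _)) (mul_nonneg h0 (ih _))

/-- The bound j/ρ is a fixed point of the recursion, so induction on `N` preserves it; it serves to
prove summability. -/
theorem sum_fewerThan_le {ρ : ℝ} (h0 : 0 < ρ) (h1 : ρ ≤ 1) (N j : ℕ) :
    ∑ d ∈ Finset.range N, fewerThan ρ d j ≤ j / ρ := by
  induction N generalizing j with
  | zero =>
    simp only [Finset.range_zero, Finset.sum_empty]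
    positivity
  | succ N ih =>
    rcases j with _ | j
    · have : ∀ d, fewerThan ρ d 0 = 0 := fun d => by cases d <;> rfl
      simp [this]
    · rw [Finset.sum_range_succ']
      simp only [fewerThan, Finset.sum_add_distrib, ← Finset.mul_sum]
      have e1 := mul_le_mul_of_nonneg_left (ih (j + 1)) (sub_nonneg.2 h1)
      have e2 := mul_le_mul_of_nonneg_left (ih j) h0.le
      have e3 : (1 - ρ) * (((j + 1 : ℕ) : ℝ) / ρ) + ρ * ((j : ℝ) / ρ) + 1
          = ((j + 1 : ℕ) : ℝ) / ρ := by
        push_cast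
        field_simp
        ring
      linarith

/-- This is the tail-sum formula for the mean number of trials up to the j-th success. Summing the
recursion gives S(j+1) = 1 + (1-ρ)S(j+1) + ρS(j), so S grows by 1/ρ at each step. -/
theorem hasSum_fewerThan {ρ : ℝ} (h0 : 0 < ρ) (h1 : ρ ≤ 1) (j : ℕ) :
    HasSum (fun d => fewerThan ρ d j) (j / ρ) := by
  have hs : ∀ j, Summable fun d => fewerThan ρ d j := fun j =>
    summable_of_sum_range_le (fun d => fewerThan_nonneg h0.le h1 d j)
      (fun N => sum_fewerThan_le h0 h1 N j)
  rw [(hs j).hasSum_iff]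
  induction j with
  | zero =>
    have : ∀ d, fewerThan ρ d 0 = 0 := fun d => by cases d <;> rfl
    simp [this]
  | succ j ih =>
    have h := (hs (j + 1)).tsum_eq_zero_add
    simp only [fewerThan] at h
    rw [((hs (j + 1)).mul_left _).tsum_add ((hs j).mul_left _), tsum_mul_left, tsum_mul_left,
      ih] at h
    push_cast
    field_simp at h ⊢
    linarith

/-! ### The filtration of the initial state and the kinds. -/

instance : DiscreteMeasurableSpace State := ⟨fun _ => trivial⟩

instance : DiscreteMeasurableSpace Kind := ⟨fun _ => trivial⟩

instance : Countable State :=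
  Function.Injective.countable (f := fun x : State => match x with
    | .side i => some i
    | .free => none) fun x y h => by cases x <;> cases y <;> simp_all

/-- The events that are determined by the state at time `0` and the kinds of the first `m`
players. -/
abbrev past {Ω : Type*} (X : Ω → State) (kind : ℕ → Ω → Kind) (m : ℕ) : MeasurableSpace Ω :=
  MeasurableSpace.comap (fun ω => (X ω, fun l : Finset.range m => kind l ω)) inferInstance

section Past

variable {Ω : Type*} (X : Ω → State) (kind : ℕ → Ω → Kind)

theorem measurable_state_past (m : ℕ) : Measurable[past X kind m] X :=
  measurable_fst.comp (comap_measurable _)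

theorem measurable_kind_past {l m : ℕ} (h : l < m) : Measurable[past X kind m] (kind l) := by
  have hcoord : Measurable fun z : State × (Finset.range m → Kind) =>
      z.2 ⟨l, Finset.mem_range.2 h⟩ := (measurable_pi_apply _).comp measurable_snd
  exact hcoord.comp (comap_measurable _)

theorem past_le {m : ℕ} (M : MeasurableSpace Ω) (hX : Measurable[M] X)
    (hk : ∀ l < m, Measurable[M] (kind l)) : past X kind m ≤ M :=
  Measurable.comap_le (hX.prodMk (measurable_pi_lambda _ fun l => hk l (Finset.mem_range.1 l.2)))

theorem past_mono {m m' : ℕ} (h : m ≤ m') : past X kind m ≤ past X kind m' :=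
  past_le X kind _ (measurable_state_past X kind m') fun _ hl =>
    measurable_kind_past X kind (hl.trans_le h)

theorem measurable_stateBefore (m : ℕ) :
    Measurable[past X kind m] fun ω => stateBefore (X ω) (fun l => kind l ω) m := by
  induction m with
  | zero => exact measurable_state_past X kind 0
  | succ m ih =>
    have hnext : Measurable fun z : State × Kind => next z.1 z.2 := Measurable.of_discrete
    exact hnext.comp ((ih.mono (past_mono X kind m.le_succ) le_rfl).prodMk
      (measurable_kind_past X kind m.lt_succ_self))

theorem measurable_served (k : Kind) (n d : ℕ) :
    Measurable[past X kind (n + 1 + d)] fun ω => served k (fun l => kind l ω) n d := by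
  induction d with
  | zero => exact @measurable_const _ _ _ (past X kind (n + 1 + 0)) 0
  | succ d ih =>
    have hadd : Measurable fun z : ℕ × Kind => z.1 + if compatible z.2 k then 1 else 0 :=
      Measurable.of_discrete
    exact hadd.comp ((ih.mono (past_mono X kind (by omega)) le_rfl).prodMk
      (measurable_kind_past X kind (by omega)))

/-- The queue evolves without reference to the gaps; this is what later makes the event independent
of the length of the period. -/
theorem measurableSet_isWaiting (n m : ℕ) :
    MeasurableSet[past X kind m] {ω | IsWaiting (X ω) (fun l => kind l ω) n m} := by
  rcases le_or_gt m n with h | h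
  · simp only [not_isWaiting_of_le h, Set.ofPred_false]
    exact @MeasurableSet.empty _ (past X kind m)
  · obtain ⟨d, rfl⟩ := Nat.exists_eq_add_of_le (Nat.succ_le_of_lt h)
    simp only [Nat.succ_eq_add_one, isWaiting_iff]
    have hS : MeasurableSet {z : Kind × State × (Kind → ℕ) |
        ∃ i, numAhead z.1 z.2.1 = some i ∧ z.2.2 z.1 < i + 1} := MeasurableSet.of_discrete
    have hle := past_mono X kind (m := n) (m' := n + 1 + d) (by omega)
    -- The kind of player `n` is random, so the counts for all kinds are carried along and evaluated
    -- at it afterwards.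
    have hm : Measurable[past X kind (n + 1 + d)] fun ω =>
        (kind n ω, stateBefore (X ω) (fun l => kind l ω) n,
          fun k => served k (fun l => kind l ω) n d) :=
      (measurable_kind_past X kind (by omega)).prodMk
        (((measurable_stateBefore X kind n).mono hle le_rfl).prodMk
          (@measurable_pi_lambda _ _ _ (past X kind (n + 1 + d)) _ _
            fun k => measurable_served X kind k n d))
    exact hm hS

end Past

/-! ### Expected waiting times under the stationary input. -/

theorem arrivalRate_nonneg {a b c : ℝ} (ha : 0 ≤ a) (hb : 0 ≤ b) (hc : 0 < c) (k : Kind) :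
    0 ≤ arrivalRate a b c k := by
  cases k
  exacts [ha, hb, hc.le]

theorem serviceRate_pos {a b c : ℝ} (ha : 0 ≤ a) (hb : 0 ≤ b) (hc : 0 < c) (k : Kind) :
    0 < serviceRate a b c k := by
  cases k <;> simp only [serviceRate] <;> positivity

theorem serviceRate_le {a b c : ℝ} (ha : 0 ≤ a) (hb : 0 ≤ b) (k : Kind) :
    serviceRate a b c k ≤ a + b + c := by
  cases k <;> simp only [serviceRate] <;> linarith

theorem transitionRate_nonneg {a b c : ℝ} (ha : 0 ≤ a) (hb : 0 ≤ b) (hc : 0 < c) (x y : State) :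
    0 ≤ transitionRate a b c x y := by
  rw [transitionRate_eq_sum]
  refine Finset.sum_nonneg fun k _ => ?_
  split_ifs
  exacts [arrivalRate_nonneg ha hb hc k, le_rfl]

section Input

variable {Ω : Type*} [MeasurableSpace Ω] {P : Measure Ω}
  {a b c : ℝ} {p : State → ℝ} {X : Ω → State} {kind : ℕ → Ω → Kind} {gap : ℕ → Ω → ℝ}

theorem IsStationaryInput.past_le (h : IsStationaryInput a b c p P X kind gap) (m : ℕ) :
    past X kind m ≤ ‹MeasurableSpace Ω› :=
  SideQueue.past_le X kind _ h.measurable_state fun l _ => h.measurable_kind l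

theorem IsStationaryInput.measure_kind (h : IsStationaryInput a b c p P X kind gap)
    (ha : 0 ≤ a) (hb : 0 ≤ b) (hc : 0 < c) (m : ℕ) (q : Kind → Prop) [DecidablePred q] :
    P {ω | q (kind m ω)}
      = ENNReal.ofReal ((∑ k, if q k then arrivalRate a b c k else 0) / (a + b + c)) := by
  have hS : MeasurableSet {ω | q (kind m ω)} :=
    h.measurable_kind m (MeasurableSet.of_discrete (s := {k | q k}))
  rw [measure_eq_tsum_inter_fiber P hS (h.measurable_kind m), tsum_fintype, Finset.sum_div,
    ENNReal.ofReal_sum_of_nonneg]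
  · refine Finset.sum_congr rfl fun k _ => ?_
    split_ifs with hq
    · rw [← h.law_kind m k]
      congr 1
      ext ω
      simp only [Set.mem_inter_iff, Set.mem_ofPred_eq, Set.mem_preimage, Set.mem_singleton_iff]
      exact ⟨fun hω => hω.2, fun hω => ⟨hω ▸ hq, hω⟩⟩
    · rw [zero_div, ENNReal.ofReal_zero]
      convert measure_empty (μ := P)
      ext ω
      simp only [Set.mem_inter_iff, Set.mem_ofPred_eq, Set.mem_preimage, Set.mem_singleton_iff,
        Set.mem_empty_iff_false, iff_false]
      exact fun hω => hq (hω.2 ▸ hω.1)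
  · intro k _
    refine div_nonneg ?_ (by positivity)
    split_ifs
    exacts [arrivalRate_nonneg ha hb hc k, le_rfl]

theorem IsStationaryInput.measure_compatible (h : IsStationaryInput a b c p P X kind gap)
    (ha : 0 ≤ a) (hb : 0 ≤ b) (hc : 0 < c) (m : ℕ) (k : Kind) :
    P {ω | compatible (kind m ω) k = true}
      = ENNReal.ofReal (serviceRate a b c k / (a + b + c)) := by
  rw [h.measure_kind ha hb hc m (fun k' => compatible k' k = true), sum_kind]
  cases k <;> simp [compatible, serviceRate, arrivalRate]

theorem IsStationaryInput.measure_not_compatible (h : IsStationaryInput a b c p P X kind gap)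
    (ha : 0 ≤ a) (hb : 0 ≤ b) (hc : 0 < c) (m : ℕ) (k : Kind) :
    P {ω | ¬ compatible (kind m ω) k = true}
      = ENNReal.ofReal (1 - serviceRate a b c k / (a + b + c)) := by
  have : a + b + c ≠ 0 := by positivity
  rw [h.measure_kind ha hb hc m (fun k' => ¬ compatible k' k = true), sum_kind]
  congr 1
  field_simp
  cases k <;> simp [compatible, serviceRate, arrivalRate]

variable [IsProbabilityMeasure P]

theorem IsStationaryInput.indep_past_kind (h : IsStationaryInput a b c p P X kind gap) (m : ℕ) :
    Indep (past X kind m) (MeasurableSpace.comap (kind m) inferInstance) P := by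
  have hk := h.measurable_kind
  have h1 : IndepFun (fun ω (l : Finset.range m) => kind l ω) (kind m) P :=
    (h.indep_kind.indepFun_finset (Finset.range m) {m} (by simp) h.measurable_kind).comp
      (φ := id)
      (ψ := fun z : ({m} : Finset ℕ) → Kind => z ⟨m, Finset.mem_singleton_self m⟩)
      measurable_id (measurable_pi_apply _)
  have h2 : IndepFun X (fun ω => ((fun l : Finset.range m => kind l ω), kind m ω)) P :=
    h.indep_state.comp (φ := id)
      (ψ := fun z : (ℕ → Kind) × (ℕ → ℝ) => ((fun l : Finset.range m => z.1 l), z.1 m))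
      measurable_id (by fun_prop)
  exact indepFun_prodMk_left h.measurable_state (by fun_prop) (hk m) h2 h1

theorem IsStationaryInput.indep_past_gap (h : IsStationaryInput a b c p P X kind gap) (m n : ℕ) :
    Indep (past X kind m) (MeasurableSpace.comap (gap n) inferInstance) P := by
  have hk := h.measurable_kind
  have hg := h.measurable_gap
  have h1 : IndepFun (fun ω (l : Finset.range m) => kind l ω) (gap n) P :=
    h.indep_kind_gap.comp (φ := fun z : ℕ → Kind => fun l : Finset.range m => z l)
      (ψ := fun z : ℕ → ℝ => z n) (by fun_prop) (by fun_prop)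
  have h2 : IndepFun X (fun ω => ((fun l : Finset.range m => kind l ω), gap n ω)) P :=
    h.indep_state.comp (φ := id)
      (ψ := fun z : (ℕ → Kind) × (ℕ → ℝ) => ((fun l : Finset.range m => z.1 l), z.2 n))
      measurable_id (by fun_prop)
  exact indepFun_prodMk_left h.measurable_state (by fun_prop) (hg n) h2 h1

theorem IsStationaryInput.measure_inter_kind (h : IsStationaryInput a b c p P X kind gap)
    {m : ℕ} {F : Set Ω} (hF : MeasurableSet[past X kind m] F) (q : Kind → Prop) :
    P (F ∩ {ω | q (kind m ω)}) = P F * P {ω | q (kind m ω)} :=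
  (Indep_iff _ _ P).1 (h.indep_past_kind m) F _ hF ⟨{k | q k}, MeasurableSet.of_discrete, rfl⟩

/-- Splitting on whether the last arrival is compatible reproduces the recursion of `fewerThan`. The
event `F` may involve the kind of player `n` and the state found on arrival. -/
theorem IsStationaryInput.measure_inter_served_lt (h : IsStationaryInput a b c p P X kind gap)
    (ha : 0 ≤ a) (hb : 0 ≤ b) (hc : 0 < c) (k : Kind) {n : ℕ} {F : Set Ω}
    (hF : MeasurableSet[past X kind (n + 1)] F) (d j : ℕ) :
    P (F ∩ {ω | served k (fun l => kind l ω) n d < j})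
      = P F * ENNReal.ofReal (fewerThan (serviceRate a b c k / (a + b + c)) d j) := by
  have htot : 0 < a + b + c := by positivity
  have hρ0 : 0 ≤ serviceRate a b c k / (a + b + c) :=
    div_nonneg (serviceRate_pos ha hb hc k).le htot.le
  have hρ1 : serviceRate a b c k / (a + b + c) ≤ 1 :=
    (div_le_one htot).2 (serviceRate_le ha hb k)
  induction d generalizing j with
  | zero => cases j <;> simp [served, fewerThan]
  | succ d ih =>
    rcases j with _ | j
    · simp [fewerThan]
    have hmeas : ∀ j, MeasurableSet[past X kind (n + 1 + d)]
        (F ∩ {ω | served k (fun l => kind l ω) n d < j}) := fun j =>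
      (past_mono X kind (by omega) _ hF).inter
        (measurable_served X kind k n d (MeasurableSet.of_discrete (s := {i | i < j})))
    have hsplit : F ∩ {ω | served k (fun l => kind l ω) n (d + 1) < j + 1}
        = ((F ∩ {ω | served k (fun l => kind l ω) n d < j + 1})
            ∩ {ω | ¬ compatible (kind (n + 1 + d) ω) k = true})
          ∪ ((F ∩ {ω | served k (fun l => kind l ω) n d < j})
            ∩ {ω | compatible (kind (n + 1 + d) ω) k = true}) := by
      ext ω
      by_cases hω : compatible (kind (n + 1 + d) ω) k = true <;> simp [served, hω]
    rw [hsplit, measure_union, h.measure_inter_kind (hmeas _) fun k' => ¬ compatible k' k = true,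
      h.measure_inter_kind (hmeas _) fun k' => compatible k' k = true, ih, ih,
      h.measure_compatible ha hb hc, h.measure_not_compatible ha hb hc, fewerThan,
      ENNReal.ofReal_add, ENNReal.ofReal_mul, ENNReal.ofReal_mul]
    · ring
    · exact hρ0
    · exact sub_nonneg.2 hρ1
    · exact mul_nonneg (sub_nonneg.2 hρ1) (fewerThan_nonneg hρ0 hρ1 _ _)
    · exact mul_nonneg hρ0 (fewerThan_nonneg hρ0 hρ1 _ _)
    · exact Set.disjoint_left.2 fun ω h1 h2 => h1.2 h2.2
    · exact (h.past_le _ _ (hmeas _)).inter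
        (h.measurable_kind _ (MeasurableSet.of_discrete (s := {k' | compatible k' k = true})))

/-- Arriving players see the stationary distribution. -/
theorem IsStationaryInput.law_stateBefore (h : IsStationaryInput a b c p P X kind gap)
    (ha : 0 ≤ a) (hb : 0 ≤ b) (hc : 0 < c) (hp : IsStationary a b c p) (m : ℕ) (y : State) :
    P {ω | stateBefore (X ω) (fun l => kind l ω) m = y} = ENNReal.ofReal (p y) := by
  have htot : 0 < a + b + c := by positivity
  have hY : ∀ m (y : State), MeasurableSet[past X kind m]
      {ω | stateBefore (X ω) (fun l => kind l ω) m = y} := fun m y =>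
    measurable_stateBefore X kind m (MeasurableSet.of_discrete (s := {y}))
  induction m generalizing y with
  | zero => exact h.law_state y
  | succ m ih =>
    rw [measure_eq_tsum_inter_fiber P (h.past_le _ _ (hY (m + 1) y))
      ((measurable_stateBefore X kind m).mono (h.past_le m) le_rfl)]
    -- One step of the embedded chain has probability `transitionRate`/(a+b+c), so invariance is the
    -- balance equation divided by the total rate.
    have hterm : ∀ x, P ({ω | stateBefore (X ω) (fun l => kind l ω) (m + 1) = y} ∩
        (fun ω => stateBefore (X ω) (fun l => kind l ω) m) ⁻¹' {x})
        = ENNReal.ofReal (p x * transitionRate a b c x y / (a + b + c)) := by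
      intro x
      rw [mul_div_assoc, ENNReal.ofReal_mul (hp.nonneg x), ← ih x, transitionRate_eq_sum,
        ← h.measure_kind ha hb hc m (fun k => next x k = y),
        ← h.measure_inter_kind (hY m x) fun k => next x k = y]
      congr 1
      ext ω
      simp only [stateBefore, Set.mem_inter_iff, Set.mem_ofPred_eq, Set.mem_preimage,
        Set.mem_singleton_iff]
      constructor
      · rintro ⟨h1, h2⟩
        exact ⟨h2, h2 ▸ h1⟩
      · rintro ⟨h1, h2⟩
        exact ⟨h1.symm ▸ h2, h1⟩
    have hle : ∀ x, transitionRate a b c x y ≤ a + b + c := fun x =>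
      le_hasSum (hasSum_transitionRate a b c x) y fun z _ => transitionRate_nonneg ha hb hc x z
    have hsum : Summable fun x => p x * transitionRate a b c x y :=
      Summable.of_nonneg_of_le
        (fun x => mul_nonneg (hp.nonneg x) (transitionRate_nonneg ha hb hc x y))
        (fun x => mul_le_mul_of_nonneg_left (hle x) (hp.nonneg x))
        (hp.hasSum_one.summable.mul_right (a + b + c))
    simp only [hterm]
    rw [← ENNReal.ofReal_tsum_of_nonneg (fun x => div_nonneg
      (mul_nonneg (hp.nonneg x) (transitionRate_nonneg ha hb hc x y)) htot.le)
      (hsum.div_const _), tsum_div_const, hp.tsum_inflow, mul_div_cancel_right₀ _ htot.ne']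

theorem IsStationaryInput.measure_isWaiting (h : IsStationaryInput a b c p P X kind gap)
    (ha : 0 ≤ a) (hb : 0 ≤ b) (hc : 0 < c) (hp : IsStationary a b c p) (k : Kind) (n d : ℕ) :
    P ({ω | kind n ω = k} ∩ {ω | IsWaiting (X ω) (fun l => kind l ω) n (n + 1 + d)})
      = ∑' x, ENNReal.ofReal (p x) * ENNReal.ofReal (arrivalRate a b c k / (a + b + c)) *
        (numAhead k x).elim 0 fun i => ENNReal.ofReal
          (fewerThan (serviceRate a b c k / (a + b + c)) d (i + 1)) := by
  have hK : MeasurableSet {ω | kind n ω = k} :=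
    h.measurable_kind n (MeasurableSet.of_discrete (s := {k}))
  rw [measure_eq_tsum_inter_fiber P
    (hK.inter (h.past_le _ _ (measurableSet_isWaiting X kind n (n + 1 + d))))
    ((measurable_stateBefore X kind n).mono (h.past_le n) le_rfl)]
  refine tsum_congr fun x => ?_
  have hYx : MeasurableSet[past X kind n] {ω | stateBefore (X ω) (fun l => kind l ω) n = x} :=
    measurable_stateBefore X kind n (MeasurableSet.of_discrete (s := {x}))
  have hF : MeasurableSet[past X kind (n + 1)]
      ({ω | stateBefore (X ω) (fun l => kind l ω) n = x} ∩ {ω | kind n ω = k}) :=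
    (past_mono X kind n.le_succ _ hYx).inter
      (measurable_kind_past X kind n.lt_succ_self (MeasurableSet.of_discrete (s := {k})))
  rw [← h.law_stateBefore ha hb hc hp n x, ← h.law_kind n k,
    ← h.measure_inter_kind hYx fun k' => k' = k]
  cases hx : numAhead k x with
  | none =>
    rw [Option.elim_none, mul_zero]
    convert measure_empty (μ := P)
    ext ω
    simp only [isWaiting_iff, Set.mem_inter_iff, Set.mem_ofPred_eq, Set.mem_preimage,
      Set.mem_singleton_iff, Set.mem_empty_iff_false, iff_false]
    rintro ⟨⟨h1, i, h2, -⟩, h3⟩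
    simp [h1, h3, hx] at h2
  | some i =>
    rw [Option.elim_some, ← h.measure_inter_served_lt ha hb hc k hF]
    congr 1
    ext ω
    simp only [isWaiting_iff, Set.mem_inter_iff, Set.mem_ofPred_eq, Set.mem_preimage,
      Set.mem_singleton_iff]
    constructor
    · rintro ⟨⟨rfl, i', h2, h3⟩, rfl⟩
      obtain rfl : i = i' := by simpa using hx.symm.trans h2
      exact ⟨⟨rfl, rfl⟩, h3⟩
    · rintro ⟨⟨rfl, rfl⟩, h3⟩
      exact ⟨⟨rfl, i, hx, h3⟩, rfl⟩

/-- The sum is the expected number of periods waited on the event that player `n` has kind `k`.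
Exchanging the sums over periods and states leaves (i+1)/ρ for each state. -/
theorem IsStationaryInput.tsum_measure_isWaiting (h : IsStationaryInput a b c p P X kind gap)
    (ha : 0 ≤ a) (hb : 0 ≤ b) (hc : |a - b| < c) (hp : IsStationary a b c p) (k : Kind) (n : ℕ) :
    ∑' m, P ({ω | kind n ω = k} ∩ {ω | IsWaiting (X ω) (fun l => kind l ω) n m})
      = ENNReal.ofReal (arrivalRate a b c k * p (.side 0) * relativeLoad a b c k
          / serviceRate a b c k) := by
  have hc0 : 0 < c := (abs_nonneg _).trans_lt hc
  have htot : 0 < a + b + c := by positivity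
  have hserv := serviceRate_pos ha hb hc0 k
  have hρ0 : 0 < serviceRate a b c k / (a + b + c) := div_pos hserv htot
  have hρ1 : serviceRate a b c k / (a + b + c) ≤ 1 :=
    (div_le_one htot).2 (serviceRate_le ha hb k)
  have harr : 0 ≤ arrivalRate a b c k / (a + b + c) :=
    div_nonneg (arrivalRate_nonneg ha hb hc0 k) htot.le
  -- Player `n` is not in the queue before arrivals `m ≤ n`, so the sum starts at `n + 1`.
  rw [← (add_right_injective (n + 1)).tsum_eq]
  swap
  · intro m hm
    by_cases hmn : m ≤ n
    · simp [not_isWaiting_of_le hmn] at hm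
    · exact ⟨m - (n + 1), by simp only; omega⟩
  simp only [h.measure_isWaiting ha hb hc0 hp]
  rw [ENNReal.tsum_comm]
  have hterm : ∀ x, ∑' d, ENNReal.ofReal (p x) *
      ENNReal.ofReal (arrivalRate a b c k / (a + b + c)) *
        ((numAhead k x).elim 0 fun i => ENNReal.ofReal
          (fewerThan (serviceRate a b c k / (a + b + c)) d (i + 1)))
      = ENNReal.ofReal (arrivalRate a b c k / (a + b + c) * p (.side 0)
          / (serviceRate a b c k / (a + b + c)) *
          (weight a b c x * (numAhead k x).elim 0 (fun i => (i : ℝ) + 1))) := by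
    intro x
    rw [ENNReal.tsum_mul_left]
    cases hx : numAhead k x with
    | none => simp
    | some i =>
      simp only [Option.elim_some]
      have hs := hasSum_fewerThan hρ0 hρ1 (i + 1)
      rw [← ENNReal.ofReal_tsum_of_nonneg (fun d => fewerThan_nonneg hρ0.le hρ1 d _) hs.summable,
        hs.tsum_eq, ← ENNReal.ofReal_mul (hp.nonneg x),
        ← ENNReal.ofReal_mul (mul_nonneg (hp.nonneg x) harr), hp.eq_weight ha hb hc x]
      congr 1
      push_cast
      ring
  simp only [hterm]
  have hs := (hasSum_weight_mul_numAhead ha hb hc k).mul_left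
    (arrivalRate a b c k / (a + b + c) * p (.side 0) / (serviceRate a b c k / (a + b + c)))
  rw [← ENNReal.ofReal_tsum_of_nonneg _ hs.summable, hs.tsum_eq]
  · congr 1
    field_simp
  · intro x
    refine mul_nonneg (div_nonneg (mul_nonneg harr (hp.nonneg _)) hρ0.le)
      (mul_nonneg (weight_nonneg ha hb hc x) ?_)
    cases numAhead k x
    · exact le_rfl
    · simp only [Option.elim_some]
      positivity

theorem IsStationaryInput.setLIntegral_gap (h : IsStationaryInput a b c p P X kind gap)
    (htot : 0 < a + b + c) {m : ℕ} {F : Set Ω} (hF : MeasurableSet[past X kind m] F) (n : ℕ) :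
    ∫⁻ ω in F, ENNReal.ofReal (gap n ω) ∂P = P F * ENNReal.ofReal (1 / (a + b + c)) := by
  have hF' := h.past_le m _ hF
  have hind : Measurable[past X kind m] (F.indicator fun _ => (1 : ℝ≥0∞)) :=
    (@measurable_const _ _ _ (past X kind m) (1 : ℝ≥0∞)).indicator hF
  have hgap : Measurable[MeasurableSpace.comap (gap n) inferInstance]
      fun ω => ENNReal.ofReal (gap n ω) :=
    ENNReal.measurable_ofReal.comp (comap_measurable (gap n))
  have key := lintegral_mul_eq_lintegral_mul_lintegral_of_independent_measurableSpace
    (h.past_le m) (h.measurable_gap n).comap_le (h.indep_past_gap m n) hind hgap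
  rw [lintegral_indicator_const hF', one_mul,
    ← lintegral_map ENNReal.measurable_ofReal (h.measurable_gap n), h.law_gap n,
    lintegral_ofReal_expMeasure htot] at key
  rw [← key, ← lintegral_indicator hF']
  refine lintegral_congr fun ω => ?_
  by_cases hω : ω ∈ F <;> simp [hω]

theorem IsStationaryInput.setLIntegral_waitingTime (h : IsStationaryInput a b c p P X kind gap)
    (ha : 0 ≤ a) (hb : 0 ≤ b) (hc : |a - b| < c) (hp : IsStationary a b c p) (k : Kind) (n : ℕ) :
    ∫⁻ ω in {ω | kind n ω = k}, waitingTime (X ω) (fun m => kind m ω) (fun m => gap m ω) n ∂P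
      = ENNReal.ofReal (arrivalRate a b c k / (a + b + c) *
          (p (.side 0) * relativeLoad a b c k / serviceRate a b c k)) := by
  classical
  have hc0 : 0 < c := (abs_nonneg _).trans_lt hc
  have htot : 0 < a + b + c := by positivity
  have hW : ∀ m, MeasurableSet {ω | IsWaiting (X ω) (fun l => kind l ω) n m} := fun m =>
    h.past_le m _ (measurableSet_isWaiting X kind n m)
  have hterm : ∀ m, ∫⁻ ω in {ω | kind n ω = k},
      (if IsWaiting (X ω) (fun l => kind l ω) n m then ENNReal.ofReal (gap m ω) else 0) ∂P
      = P ({ω | kind n ω = k} ∩ {ω | IsWaiting (X ω) (fun l => kind l ω) n m})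
        * ENNReal.ofReal (1 / (a + b + c)) := by
    intro m
    -- For `m ≤ n` the kind of player `n` lies beyond `past X kind m`. The larger index is harmless,
    -- since the gaps are independent of all the kinds.
    have hF : MeasurableSet[past X kind (max m (n + 1))]
        ({ω | kind n ω = k} ∩ {ω | IsWaiting (X ω) (fun l => kind l ω) n m}) :=
      MeasurableSet.inter (measurable_kind_past X kind (by omega)
          (MeasurableSet.of_discrete (s := {k})))
        (past_mono X kind (le_max_left _ _) _ (measurableSet_isWaiting X kind n m))
    rw [← h.setLIntegral_gap htot hF m, Set.inter_comm, ← Measure.restrict_restrict (hW m),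
      ← lintegral_indicator (hW m)]
    rfl
  simp only [waitingTime]
  rw [lintegral_tsum]
  · rw [tsum_congr hterm, ENNReal.tsum_mul_right, h.tsum_measure_isWaiting ha hb hc hp,
      mul_comm, ← ENNReal.ofReal_mul (by positivity)]
    congr 1
    ring
  · exact fun m => (Measurable.ite (hW m) (h.measurable_gap m).ennreal_ofReal
      measurable_const).aemeasurable

theorem IsStationaryInput.meanWaitOf_eq (h : IsStationaryInput a b c p P X kind gap)
    (ha : 0 ≤ a) (hb : 0 ≤ b) (hc : |a - b| < c) (hp : IsStationary a b c p) {k : Kind}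
    (hk : 0 < arrivalRate a b c k) (n : ℕ) :
    meanWaitOf P X kind gap k n
      = ENNReal.ofReal (p (.side 0) * relativeLoad a b c k / serviceRate a b c k) := by
  have hc0 : 0 < c := (abs_nonneg _).trans_lt hc
  have hpos : 0 < arrivalRate a b c k / (a + b + c) := div_pos hk (by positivity)
  rw [meanWaitOf, meanWait, ProbabilityTheory.cond, lintegral_smul_measure,
    h.setLIntegral_waitingTime ha hb hc hp, h.law_kind, ENNReal.ofReal_mul hpos.le, smul_eq_mul,
    ← mul_assoc, ENNReal.inv_mul_cancel (by simpa using hpos) ENNReal.ofReal_ne_top, one_mul]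

theorem IsStationaryInput.meanWait_eq (h : IsStationaryInput a b c p P X kind gap)
    (ha : 0 ≤ a) (hb : 0 ≤ b) (hc : |a - b| < c) (hp : IsStationary a b c p) (n : ℕ) :
    meanWait P X kind gap n
      = ENNReal.ofReal (∑ k, arrivalRate a b c k / (a + b + c) *
          (p (.side 0) * relativeLoad a b c k / serviceRate a b c k)) := by
  have hc0 : 0 < c := (abs_nonneg _).trans_lt hc
  rw [ENNReal.ofReal_sum_of_nonneg]
  · simp only [← h.setLIntegral_waitingTime ha hb hc hp _ n]
    have hunion : ⋃ k, {ω | kind n ω = k} = Set.univ := by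
      ext ω
      simp
    rw [meanWait, ← setLIntegral_univ, ← hunion, lintegral_iUnion, tsum_fintype]
    · exact fun k => h.measurable_kind n (MeasurableSet.of_discrete (s := {k}))
    · exact fun k k' hkk' => Set.disjoint_left.2 fun ω h1 h2 =>
        hkk' ((h1 : kind n ω = k).symm.trans h2)
  · intro k _
    have h1 := arrivalRate_nonneg ha hb hc0 k
    have h2 := serviceRate_pos ha hb hc0 k
    have h3 := hp.nonneg (.side 0)
    have h4 : 0 ≤ relativeLoad a b c k := by
      cases k <;> simp only [relativeLoad] <;> positivity
    positivity

end Input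

end SideQueue

/-! ### Assembling the closed formulas. -/

theorem mainTheorem4 (lamA lamB lamC lamTot : ℝ) (hA : 0 ≤ lamA) (hB : 0 ≤ lamB)
    (hC : |lamA - lamB| < lamC) (hTot : lamTot = lamA + lamB + lamC) :
    (∃! p : SideQueue.State → ℝ, SideQueue.IsStationary lamA lamB lamC p) ∧
    ∀ p : SideQueue.State → ℝ, SideQueue.IsStationary lamA lamB lamC p →
      p (.side 0) = (lamA / (lamB + lamC - lamA) + lamB / (lamA + lamC - lamB)
        + lamC * lamTot⁻¹ + 1)⁻¹ ∧
      ∀ {Ω : Type*} [MeasurableSpace Ω] (P : Measure Ω) [IsProbabilityMeasure P]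
        (X : Ω → SideQueue.State) (kind : ℕ → Ω → SideQueue.Kind) (gap : ℕ → Ω → ℝ),
        SideQueue.IsStationaryInput lamA lamB lamC p P X kind gap → ∀ n : ℕ,
          (0 < lamA → SideQueue.meanWaitOf P X kind gap .A n
            = ENNReal.ofReal ((lamB + lamC) * p (.side 0) / (lamB + lamC - lamA) ^ 2)) ∧
          (0 < lamB → SideQueue.meanWaitOf P X kind gap .B n
            = ENNReal.ofReal ((lamA + lamC) * p (.side 0) / (lamA + lamC - lamB) ^ 2)) ∧
          SideQueue.meanWaitOf P X kind gap .C n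
            = ENNReal.ofReal (p (.side 0) / (lamA + lamB + lamC)) ∧
          SideQueue.meanWait P X kind gap n
            = ENNReal.ofReal (1 / (2 * (lamA + lamC - lamB)) + 1 / (2 * (lamB + lamC - lamA))
                + 1 / (lamA + lamB + lamC) - 1 / (2 * lamC)
                - (lamA + lamB + 2 * lamC)
                  / (2 * (2 * lamA * lamB + lamA * lamC + lamB * lamC + lamC ^ 2))) ∧
          (0 < lamB →
            SideQueue.meanWaitOf P X kind gap .C n / SideQueue.meanWaitOf P X kind gap .B n
              = ENNReal.ofReal ((lamTot - 2 * lamB) ^ 2 / (lamTot * (lamTot - lamB)))) := by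
  subst hTot
  obtain ⟨h1, h2⟩ := abs_lt.1 hC
  have hC0 : 0 < lamC := (abs_nonneg _).trans_lt hC
  have hBC : 0 < lamB + lamC := by linarith
  have hAC : 0 < lamA + lamC := by linarith
  have hBCA : 0 < lamB + lamC - lamA := by linarith
  have hACB : 0 < lamA + lamC - lamB := by linarith
  have hT : 0 < lamA + lamB + lamC := by linarith
  refine ⟨⟨_, SideQueue.isStationary_weight hA hB hC, fun p hp => ?_⟩, fun p hp => ?_⟩
  · funext x
    rw [hp.eq_weight hA hB hC x, hp.side_zero_eq hA hB hC]
  have hp0 := hp.side_zero_eq hA hB hC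
  have hp0_pos : 0 < p (.side 0) := hp0 ▸ inv_pos.2 (SideQueue.normalization_pos hA hB hC)
  refine ⟨hp0, fun P _ X kind gap h n => ?_⟩
  have hTB : 0 < lamB → SideQueue.meanWaitOf P X kind gap .B n
      = ENNReal.ofReal ((lamA + lamC) * p (.side 0) / (lamA + lamC - lamB) ^ 2) := by
    intro hpos
    rw [h.meanWaitOf_eq hA hB hC hp (k := .B) hpos n]
    congr 1
    simp only [SideQueue.relativeLoad, SideQueue.serviceRate]
    field_simp
  have hTC : SideQueue.meanWaitOf P X kind gap .C n
      = ENNReal.ofReal (p (.side 0) / (lamA + lamB + lamC)) := by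
    rw [h.meanWaitOf_eq hA hB hC hp (k := .C) hC0 n]
    simp only [SideQueue.relativeLoad, SideQueue.serviceRate, mul_one]
  refine ⟨fun hpos => ?_, hTB, hTC, ?_, fun hpos => ?_⟩
  · rw [h.meanWaitOf_eq hA hB hC hp (k := .A) hpos n]
    congr 1
    simp only [SideQueue.relativeLoad, SideQueue.serviceRate]
    field_simp
  · rw [h.meanWait_eq hA hB hC hp n, SideQueue.sum_kind, hp0]
    congr 1
    simp only [SideQueue.relativeLoad, SideQueue.serviceRate, SideQueue.arrivalRate]
    have hD : 0 < 2 * lamA * lamB + lamA * lamC + lamB * lamC + lamC ^ 2 := by positivity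
    -- Over a common denominator the normalization has numerator 2λ_C times the quadratic form in
    -- the last term of E[T]. This explains the terms 1/(2λ_C) and that last fraction in the
    -- partial-fraction formula.
    have hN : SideQueue.normalization lamA lamB lamC
        = 2 * lamC * (2 * lamA * lamB + lamA * lamC + lamB * lamC + lamC ^ 2)
          / ((lamB + lamC - lamA) * (lamA + lamC - lamB) * (lamA + lamB + lamC)) := by
      rw [SideQueue.normalization]
      field_simp
      ring
    rw [hN]
    field_simp
    ring
  · rw [hTB hpos, hTC, ← ENNReal.ofReal_div_of_pos (by positivity)]
    congr 1
    have e1 : lamA + lamB + lamC - lamB = lamA + lamC := by ring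
    have e2 : lamA + lamB + lamC - 2 * lamB = lamA + lamC - lamB := by ring
    rw [e1, e2]
    field_simp
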